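/- For a polynomial $p\in\mathbb{C}[z_1,z_2]$ let $\mathcal{I}(p)=\{(\operatorname{Im} z_1,\operatorname{Im} z_2) : (z_1,z_2)\in\mathbb{C}^2,\ p(z_1,z_2)=0\}\subseteq\mathbb{R}^2$ be its imaginary projection, and let $\mathcal{I}(p)^{\mathsf c}=\mathbb{R}^2\setminus\mathcal{I}(p)$. Let $p=(z_1-\alpha z_2)(z_1-\beta z_2)+d z_1+e z_2+f$ with $\alpha,\beta\in\mathbb{C}\setminus\mathbb{R}$ and $d,e,f\in\mathbb{C}$. Then 1. $\mathcal{I}(p)^{\mathsf c}$ has at most one bounded connected component; 2. $\mathcal{I}(p)^{\mathsf c}$ has no unbounded connected components. -/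

import Mathlib

/-- The imaginary projection of a complex polynomial in `n` variables: the image of its zero set
in `ℂⁿ` under taking imaginary parts in every coordinate. The space `Fin n → ℝ` carries the usual
topology and the usual bounded sets of `ℝⁿ`. -/
def imagProjection {n : ℕ} (p : MvPolynomial (Fin n) ℂ) : Set (Fin n → ℝ) :=
  (fun (z : Fin n → ℂ) (i : Fin n) => (z i).im) '' {z | MvPolynomial.eval z p = 0}

/-- The set of connected components of a subset `S` of a topological space (each of them is a
non-empty subset of `S`). -/
def components {X : Type*} [TopologicalSpace X] (S : Set X) : Set (Set X) :=
  {K | ∃ y ∈ S, K = connectedComponentIn S y}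

/-- The polynomial `(z₁ - α z₂) (z₁ - β z₂) + d z₁ + e z₂ + f`, where `z₁, z₂` are the variables
with indices `0, 1`. -/
noncomputable def factoredConic (α β d e f : ℂ) : MvPolynomial (Fin 2) ℂ :=
  (MvPolynomial.X 0 - MvPolynomial.C α * MvPolynomial.X 1) *
      (MvPolynomial.X 0 - MvPolynomial.C β * MvPolynomial.X 1) +
    MvPolynomial.C d * MvPolynomial.X 0 + MvPolynomial.C e * MvPolynomial.X 1 +
    MvPolynomial.C f

/-! The complement of the imaginary projection is connected and bounded (possibly empty), which
gives both claims. For `α ≠ β` a translation reduces the equation to `(z₁ - α z₂)(z₁ - β z₂) + c =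
0`. If `c = 0`, the line `z₁ = β z₂` already projects onto the plane. Otherwise the curve is `z₂ = w
+ C/w`, `z₁ = β w + α C/w` with `w ≠ 0`, and as `C/w = C conj(w)/|w|²`, real linear coordinates turn
its projection into the image of `w ↦ w + g w/|w|²` with `g` injective. The complement of that image
is star-shaped about `0` (`starConvex_compl_inversionImage`) and bounded
(`mem_inversionImage_of_large`). For `α = β` the projection is the whole plane
(`imagProjection_factoredConic_self`). -/

/-! ### Fibres of `w ↦ w + g w/|w|²`. -/

/-- The area form of the plane, `cross a b = Im (conj a * b)`. -/
def cross (a b : ℂ) : ℝ := a.re * b.im - a.im * b.re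

/-- The image of the punctured plane under `w ↦ w + g w / |w|²`. -/
def inversionImage (g : ℂ →ₗ[ℝ] ℂ) : Set ℂ :=
  {y | ∃ w : ℂ, w ≠ 0 ∧ y = w + (Complex.normSq w)⁻¹ • g w}

/-- A real quartic form whose zeros are the directions of the points of the fibre over `y`. -/
noncomputable def fibreForm (g : ℂ →ₗ[ℝ] ℂ) (y v : ℂ) : ℝ :=
  Complex.normSq v * cross v y * cross y (g v) - cross v (g v) ^ 2

lemma exists_smul_of_cross_eq_zero {v w : ℂ} (hv : v ≠ 0) (h : cross v w = 0) :
    ∃ s : ℝ, w = s • v := by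
  have hn : Complex.normSq v ≠ 0 := by simpa using hv
  refine ⟨(v.re * w.re + v.im * w.im) / Complex.normSq v, ?_⟩
  unfold cross at h
  rw [Complex.normSq_apply] at hn ⊢
  apply Complex.ext
  · simp only [Complex.smul_re, smul_eq_mul]
    rw [div_mul_eq_mul_div, eq_div_iff hn]
    linear_combination (-v.im) * h
  · simp only [Complex.smul_im, smul_eq_mul]
    rw [div_mul_eq_mul_div, eq_div_iff hn]
    linear_combination v.re * h

lemma normSq_real_smul (c : ℝ) (v : ℂ) :
    Complex.normSq (c • v) = c ^ 2 * Complex.normSq v := by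
  rw [Complex.real_smul, Complex.normSq_mul, Complex.normSq_ofReal, pow_two]

/-- By Cramer's rule `y = a v + b g v`; the vanishing of the form says `a b |v|² = 1`, so `w = a v`
is a preimage. -/
lemma mem_inversionImage_of_cross_ne_zero {g : ℂ →ₗ[ℝ] ℂ} {y v : ℂ}
    (hQ : fibreForm g y v = 0) (hv : cross v (g v) ≠ 0) : y ∈ inversionImage g := by
  set D := cross v (g v) with hD
  have hQ' : Complex.normSq v * cross v y * cross y (g v) = D ^ 2 := by
    unfold fibreForm at hQ; linarith
  have hne : Complex.normSq v * cross v y * cross y (g v) ≠ 0 := by rw [hQ']; positivity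
  have ha : cross y (g v) ≠ 0 := right_ne_zero_of_mul hne
  have hb : cross v y ≠ 0 := right_ne_zero_of_mul (left_ne_zero_of_mul hne)
  have hn : Complex.normSq v ≠ 0 := left_ne_zero_of_mul (left_ne_zero_of_mul hne)
  have hv0 : v ≠ 0 := by simpa using hn
  have hy : y = (cross y (g v) / D) • v + (cross v y / D) • g v := by
    apply Complex.ext
    · simp only [Complex.add_re, Complex.smul_re, smul_eq_mul]
      field_simp
      rw [hD]; unfold cross; ring
    · simp only [Complex.add_im, Complex.smul_im, smul_eq_mul]
      field_simp
      rw [hD]; unfold cross; ring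
  refine ⟨(cross y (g v) / D) • v, smul_ne_zero (div_ne_zero ha hv) hv0, ?_⟩
  rw [LinearMap.map_smul, smul_smul, normSq_real_smul]
  have hc : ((cross y (g v) / D) ^ 2 * Complex.normSq v)⁻¹ * (cross y (g v) / D)
      = cross v y / D := by
    field_simp
    linarith
  rw [hc]
  exact hy

/-- On the line of an eigenvector the equation is `r² - s r + κ/|v|² = 0`; the inequality makes its
discriminant nonnegative. -/
lemma mem_inversionImage_of_eigenvector {g : ℂ →ₗ[ℝ] ℂ} {v : ℂ} (hv : v ≠ 0) {κ s : ℝ}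
    (hκ : κ ≠ 0) (hg : g v = κ • v) (h : 4 * κ ≤ s ^ 2 * Complex.normSq v) :
    s • v ∈ inversionImage g := by
  have hn : 0 < Complex.normSq v := Complex.normSq_pos.mpr hv
  set N := Complex.normSq v with hN
  have hd : 0 ≤ s ^ 2 - 4 * κ / N := by
    rw [sub_nonneg, div_le_iff₀ hn]; exact h
  obtain ⟨r, hr⟩ : ∃ r : ℝ, r ^ 2 - s * r + κ / N = 0 := by
    refine ⟨(s + √(s ^ 2 - 4 * κ / N)) / 2, ?_⟩
    linear_combination (1 / 4) * Real.sq_sqrt hd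
  have hr0 : r ≠ 0 := by
    rintro rfl
    have : κ / N ≠ 0 := div_ne_zero hκ hn.ne'
    simp_all
  refine ⟨r • v, smul_ne_zero hr0 hv, ?_⟩
  rw [LinearMap.map_smul, hg, normSq_real_smul, smul_smul, smul_smul, ← add_smul, ← hN]
  congr 1
  have e : κ / N = s * r - r ^ 2 := by linarith
  have e2 : κ = (s * r - r ^ 2) * N := by rw [← e]; field_simp
  rw [e2]; field_simp; ring

lemma mem_inversionImage_of_fibreForm_eq_zero {g : ℂ →ₗ[ℝ] ℂ} (hg : Function.Injective g)
    {y v : ℂ} (hvy : cross v y ≠ 0) (hQ : fibreForm g y v = 0) : y ∈ inversionImage g := by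
  by_cases hD : cross v (g v) = 0
  · exfalso
    have hv : v ≠ 0 := by rintro rfl; simp [cross] at hvy
    obtain ⟨κ, hκ⟩ := exists_smul_of_cross_eq_zero hv hD
    have hκ0 : κ ≠ 0 := by
      rintro rfl
      exact hv (hg (by simpa using hκ))
    have hn : Complex.normSq v ≠ 0 := by simpa using hv
    have hc : cross y (g v) = -κ * cross v y := by
      rw [hκ]; simp only [cross, Complex.smul_re, Complex.smul_im, smul_eq_mul]; ring
    unfold fibreForm at hQ
    rw [hD, hc] at hQ
    have : Complex.normSq v * cross v y * (-κ * cross v y) ≠ 0 :=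
      mul_ne_zero (mul_ne_zero hn hvy) (mul_ne_zero (neg_ne_zero.mpr hκ0) hvy)
    apply this; linarith
  · exact mem_inversionImage_of_cross_ne_zero hQ hD

/-- The form is `-cross y (g y) ^ 2 ≤ 0` at `v = y`, so it has a zero on the segment from `y` to
`v`. That zero must avoid `y` itself, which is delicate when `y` is an eigenvector. -/
lemma mem_inversionImage_of_fibreForm_nonneg {g : ℂ →ₗ[ℝ] ℂ} (hg : Function.Injective g)
    {y v : ℂ} (hvy : cross v y ≠ 0) (hQ : 0 ≤ fibreForm g y v) : y ∈ inversionImage g := by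
  have hy : y ≠ 0 := by rintro rfl; simp [cross] at hvy
  set x := v - y with hx
  have hvx : v = y + (1 : ℝ) • x := by rw [hx]; simp
  have hX : cross x y = cross v y := by rw [hx]; simp only [cross, Complex.sub_re, Complex.sub_im]; ring
  have hseg (ε : ℝ) : cross (y + ε • x) y = ε * cross v y := by
    rw [← hX]
    simp only [cross, Complex.add_re, Complex.add_im, Complex.smul_re, Complex.smul_im, smul_eq_mul]
    ring
  have hn (ε : ℝ) : Complex.normSq (y + ε • x) =
      (y.re + ε * x.re) ^ 2 + (y.im + ε * x.im) ^ 2 := by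
    rw [Complex.normSq_apply]; simp; ring
  have hform (ε : ℝ) : fibreForm g y (y + ε • x) =
      ((y.re + ε * x.re) ^ 2 + (y.im + ε * x.im) ^ 2) * (ε * cross x y) *
        (cross y (g y) + ε * cross y (g x)) -
      (cross y (g y) + ε * (cross x (g y) + cross y (g x)) + ε ^ 2 * cross x (g x)) ^ 2 := by
    unfold fibreForm
    rw [hseg, hn, ← hX, map_add, map_smul]
    simp only [cross, Complex.add_re, Complex.add_im, Complex.smul_re, Complex.smul_im, smul_eq_mul]
    ring
  by_cases hD : cross y (g y) = 0
  · obtain ⟨κ, hκ⟩ := exists_smul_of_cross_eq_zero hy hD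
    have hκ0 : κ ≠ 0 := by
      rintro rfl
      exact hy (hg (by simpa using hκ))
    rcases le_or_gt (4 * κ) (Complex.normSq y) with h4 | h4
    · simpa using mem_inversionImage_of_eigenvector (s := 1) hy hκ0 hκ (by simpa using h4)
    have hny : 0 < Complex.normSq y := Complex.normSq_pos.mpr hy
    have hκpos : 0 < κ := by linarith
    have hxg : cross x (g y) = κ * cross x y := by
      rw [hκ]; simp only [cross, Complex.smul_re, Complex.smul_im, smul_eq_mul]; ring
    -- Here the form has a double zero at `ε = 0`; `P` is the quotient by `ε²`, and `P 0 < 0` by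
    -- `|y|² < 4κ` and AM-GM.
    let P : ℝ → ℝ := fun ε => ((y.re + ε * x.re) ^ 2 + (y.im + ε * x.im) ^ 2) * cross x y *
      cross y (g x) - (κ * cross x y + cross y (g x) + ε * cross x (g x)) ^ 2
    have hP (ε : ℝ) : fibreForm g y (y + ε • x) = ε ^ 2 * P ε := by
      rw [hform, hD, hxg]; simp only [P]; ring
    have hP1 : 0 ≤ P 1 := by
      have := hP 1
      rw [← hvx] at this
      linarith
    have hP0 : P 0 ≤ 0 := by
      have e : P 0 = Complex.normSq y * (cross x y * cross y (g x))
          - (κ * cross x y + cross y (g x)) ^ 2 := by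
        rw [Complex.normSq_apply]; simp only [P]; ring
      rw [e]
      rcases le_or_gt (cross x y * cross y (g x)) 0 with h | h
      · nlinarith [mul_nonneg hny.le (neg_nonneg.mpr h), sq_nonneg (κ * cross x y + cross y (g x))]
      · nlinarith [mul_lt_mul_of_pos_right h4 h, sq_nonneg (κ * cross x y - cross y (g x))]
    have hP0' : P 0 ≠ 0 := by
      have e : P 0 = Complex.normSq y * (cross x y * cross y (g x))
          - (κ * cross x y + cross y (g x)) ^ 2 := by
        rw [Complex.normSq_apply]; simp only [P]; ring
      rw [e]
      rcases lt_trichotomy (cross x y * cross y (g x)) 0 with h | h | h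
      · nlinarith [mul_pos hny (neg_pos.mpr h), sq_nonneg (κ * cross x y + cross y (g x))]
      · have hY : cross y (g x) = 0 := by
          rcases mul_eq_zero.mp h with h | h
          · exact absurd (hX ▸ h) hvy
          · exact h
        rw [h, hY]
        have : 0 < (κ * cross x y) ^ 2 := by
          have := mul_ne_zero hκ0 (hX ▸ hvy : cross x y ≠ 0)
          positivity
        linarith
      · nlinarith [mul_lt_mul_of_pos_right h4 h, sq_nonneg (κ * cross x y - cross y (g x))]
    have hcont : ContinuousOn P (Set.Icc 0 1) := by
      apply Continuous.continuousOn; simp only [P]; fun_prop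
    obtain ⟨ε, -, hε⟩ := intermediate_value_Icc zero_le_one hcont ⟨hP0, hP1⟩
    have hε0 : ε ≠ 0 := by rintro rfl; exact hP0' hε
    refine mem_inversionImage_of_fibreForm_eq_zero (v := y + ε • x) hg ?_ ?_
    · rw [hseg]; exact mul_ne_zero hε0 hvy
    · rw [hP, hε, mul_zero]
  · have hcont : ContinuousOn (fun ε : ℝ => fibreForm g y (y + ε • x)) (Set.Icc 0 1) := by
      apply Continuous.continuousOn; simp only [hform]; fun_prop
    have h0 : fibreForm g y (y + (0 : ℝ) • x) = -cross y (g y) ^ 2 := by rw [hform]; ring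
    have h0neg : -cross y (g y) ^ 2 < 0 := by
      have : 0 < cross y (g y) ^ 2 := by positivity
      linarith
    obtain ⟨ε, -, hε⟩ := intermediate_value_Icc zero_le_one hcont
      ⟨by simp only [h0]; exact h0neg.le, by simpa only [← hvx] using hQ⟩
    have hε0 : ε ≠ 0 := by
      rintro rfl
      simp only [h0] at hε
      linarith
    refine mem_inversionImage_of_fibreForm_eq_zero (v := y + ε • x) hg ?_ hε
    rw [hseg]; exact mul_ne_zero hε0 hvy

/-! ### Star-shapedness of the complement. -/

/-- For a preimage `v` of `y`, the form of `t • y` at `v` is `(t² - 1) cross v (g v) ^ 2 ≥ 0`. -/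
lemma smul_mem_inversionImage {g : ℂ →ₗ[ℝ] ℂ} (hg : Function.Injective g) {y : ℂ}
    (hy : y ∈ inversionImage g) {t : ℝ} (ht : 1 ≤ t) : t • y ∈ inversionImage g := by
  obtain ⟨v, hv, hyv⟩ := hy
  have hn : 0 < Complex.normSq v := Complex.normSq_pos.mpr hv
  set N := Complex.normSq v with hN
  have h1 : cross v y = N⁻¹ * cross v (g v) := by
    rw [hyv]
    simp only [cross, Complex.add_re, Complex.add_im, Complex.smul_re, Complex.smul_im, smul_eq_mul]
    ring
  have h2 : cross y (g v) = cross v (g v) := by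
    rw [hyv]
    simp only [cross, Complex.add_re, Complex.add_im, Complex.smul_re, Complex.smul_im, smul_eq_mul]
    ring
  by_cases hD : cross v (g v) = 0
  · obtain ⟨κ, hκ⟩ := exists_smul_of_cross_eq_zero hv hD
    have hκ0 : κ ≠ 0 := by
      rintro rfl
      exact hv (hg (by simpa using hκ))
    have e : t • y = (t * (1 + κ / N)) • v := by
      rw [hyv, hκ, mul_smul, add_smul, one_smul, smul_smul, inv_mul_eq_div]
    rw [e]
    refine mem_inversionImage_of_eigenvector hv hκ0 hκ ?_
    rw [← hN]
    have e2 : (t * (1 + κ / N)) ^ 2 * N = t ^ 2 * ((1 + κ / N) ^ 2 * N) := by ring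
    have e3 : (1 + κ / N) ^ 2 * N = 4 * κ + (1 - κ / N) ^ 2 * N := by field_simp; ring
    have h3 : 0 ≤ (1 - κ / N) ^ 2 * N := by positivity
    have h4 : 0 ≤ (1 + κ / N) ^ 2 * N := by positivity
    rw [e2]
    nlinarith [one_le_pow₀ ht (n := 2)]
  · refine mem_inversionImage_of_fibreForm_nonneg (v := v) hg ?_ ?_
    · have e : cross v (t • y) = t * (N⁻¹ * cross v (g v)) := by
        rw [← h1]; simp only [cross, Complex.smul_re, Complex.smul_im, smul_eq_mul]; ring
      rw [e]
      have : t ≠ 0 := by positivity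
      positivity
    · have e : fibreForm g (t • y) v = t ^ 2 * (N * cross v y * cross y (g v))
          - cross v (g v) ^ 2 := by
        unfold fibreForm
        simp only [cross, Complex.smul_re, Complex.smul_im, smul_eq_mul]
        ring
      rw [e, h1, h2]
      have e2 : N * (N⁻¹ * cross v (g v)) * cross v (g v) = cross v (g v) ^ 2 := by field_simp
      rw [e2]
      nlinarith [one_le_pow₀ ht (n := 2), sq_nonneg (cross v (g v))]

lemma mem_inversionImage_of_zero_mem {g : ℂ →ₗ[ℝ] ℂ} (hg : Function.Injective g)
    (h0 : (0 : ℂ) ∈ inversionImage g) (y : ℂ) : y ∈ inversionImage g := by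
  obtain ⟨v, hv, hyv⟩ := h0
  have hn : 0 < Complex.normSq v := Complex.normSq_pos.mpr hv
  have hgv : g v = (-Complex.normSq v) • v := by
    -- A preimage of `0` is an eigenvector with negative eigenvalue, which makes the form at `v` a
    -- square for every `y`.
    have h : (Complex.normSq v)⁻¹ • g v = -v := by linear_combination -hyv
    rw [← smul_inv_smul₀ hn.ne' (g v), h]; simp
  by_cases hvy : cross v y = 0
  · obtain ⟨s, rfl⟩ := exists_smul_of_cross_eq_zero hv hvy
    refine mem_inversionImage_of_eigenvector hv (neg_ne_zero.mpr hn.ne') hgv ?_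
    nlinarith [mul_nonneg (sq_nonneg s) hn.le]
  · refine mem_inversionImage_of_fibreForm_nonneg (v := v) hg hvy ?_
    have e : fibreForm g y v = (Complex.normSq v * cross v y) ^ 2 := by
      unfold fibreForm
      rw [hgv]
      simp only [cross, Complex.smul_re, Complex.smul_im, smul_eq_mul]
      ring
    rw [e]; positivity

lemma starConvex_compl_inversionImage {g : ℂ →ₗ[ℝ] ℂ} (hg : Function.Injective g) :
    StarConvex ℝ 0 (inversionImage g)ᶜ := by
  rw [starConvex_zero_iff]
  intro y hy b hb0 hb1 hby
  rcases hb0.eq_or_lt with rfl | hb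
  · rw [zero_smul] at hby
    exact hy (mem_inversionImage_of_zero_mem hg hby y)
  · apply hy
    have := smul_mem_inversionImage hg hby (t := b⁻¹) ((one_le_inv₀ hb).mpr hb1)
    rwa [inv_smul_smul₀ hb.ne'] at this

/-! ### Boundedness of the complement. -/

/-- A preimage is a fixed point of `w ↦ y - g (1 / conj w)`. On the ball of radius `‖y‖ / 2` about
`y` one has `‖w‖ ≥ ‖y‖ / 2`, and the factor 8 gives contraction ratio 1/2. -/
lemma mem_inversionImage_of_large (g : ℂ →L[ℝ] ℂ) {y : ℂ} (hy0 : y ≠ 0)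
    (hy : 8 * ‖g‖ ≤ ‖y‖ ^ 2) : y ∈ inversionImage g.toLinearMap := by
  have hyp : 0 < ‖y‖ := norm_pos_iff.mpr hy0
  let s := Metric.closedBall y (‖y‖ / 2)
  let F : ℂ → ℂ := fun w => y - g ((starRingEnd ℂ w)⁻¹)
  have hlow : ∀ w ∈ s, ‖y‖ / 2 ≤ ‖w‖ := by
    intro w hw
    have h1 : ‖w - y‖ ≤ ‖y‖ / 2 := by simpa [s, dist_eq_norm] using hw
    have h2 : ‖y‖ ≤ ‖w‖ + ‖w - y‖ := by
      calc ‖y‖ = ‖w - (w - y)‖ := by congr 1; ring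
        _ ≤ _ := norm_sub_le _ _
    linarith
  have hmaps : Set.MapsTo F s s := by
    intro w hw
    have hw1 := hlow w hw
    have hwp : 0 < ‖w‖ := by linarith
    rw [Metric.mem_closedBall, dist_eq_norm]
    have e : F w - y = -g ((starRingEnd ℂ w)⁻¹) := by simp [F]
    rw [e, norm_neg]
    refine (g.le_opNorm _).trans ?_
    rw [norm_inv, RCLike.norm_conj, ← div_eq_mul_inv, div_le_iff₀ hwp]
    nlinarith [norm_nonneg g]
  have hcontr : ContractingWith (1 / 2) (hmaps.restrict F s s) := by
    refine ⟨by norm_num, LipschitzWith.of_dist_le_mul ?_⟩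
    rintro ⟨a, ha⟩ ⟨b, hb⟩
    have ha1 := hlow a ha
    have hb1 := hlow b hb
    have hap : 0 < ‖a‖ := by linarith
    have hbp : 0 < ‖b‖ := by linarith
    have ha0 : starRingEnd ℂ a ≠ 0 := by simpa using norm_pos_iff.mp hap
    have hb0 : starRingEnd ℂ b ≠ 0 := by simpa using norm_pos_iff.mp hbp
    rw [Subtype.dist_eq, Subtype.dist_eq, Set.MapsTo.val_restrict_apply,
      Set.MapsTo.val_restrict_apply, dist_eq_norm, dist_eq_norm]
    have e : F a - F b = g ((starRingEnd ℂ b)⁻¹ - (starRingEnd ℂ a)⁻¹) := by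
      simp only [F, map_sub]; ring
    have e2 : ‖(starRingEnd ℂ b)⁻¹ - (starRingEnd ℂ a)⁻¹‖ = ‖a - b‖ / (‖b‖ * ‖a‖) := by
      rw [inv_sub_inv hb0 ha0, norm_div, norm_mul, RCLike.norm_conj, RCLike.norm_conj, ← map_sub,
        RCLike.norm_conj]
    rw [e]
    refine (g.le_opNorm _).trans ?_
    rw [e2, ← mul_div_assoc, div_le_iff₀ (by positivity)]
    have h3 : ‖y‖ / 2 * (‖y‖ / 2) ≤ ‖b‖ * ‖a‖ := by gcongr
    have h4 : ‖g‖ ≤ 1 / 2 * (‖b‖ * ‖a‖) := by nlinarith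
    push_cast
    calc ‖g‖ * ‖a - b‖ ≤ 1 / 2 * (‖b‖ * ‖a‖) * ‖a - b‖ := by gcongr
      _ = _ := by ring
  obtain ⟨w, hw, hfix, -⟩ := hcontr.exists_fixedPoint'
    (Metric.isClosed_closedBall.isComplete) hmaps
    (Metric.mem_closedBall_self (by positivity) : y ∈ s) (edist_ne_top _ _)
  have hwp : 0 < ‖w‖ := by linarith [hlow w hw]
  refine ⟨w, norm_pos_iff.mp hwp, ?_⟩
  have h : y - g ((starRingEnd ℂ w)⁻¹) = w := hfix
  have e : (starRingEnd ℂ w)⁻¹ = (Complex.normSq w)⁻¹ • w := by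
    rw [Complex.inv_def, Complex.conj_conj, Complex.normSq_conj, Complex.real_smul, mul_comm]
  rw [e, map_smul] at h
  simp only [ContinuousLinearMap.coe_coe]
  linear_combination h

lemma isBounded_compl_inversionImage (g : ℂ →ₗ[ℝ] ℂ) :
    Bornology.IsBounded (inversionImage g)ᶜ := by
  set G : ℂ →L[ℝ] ℂ := LinearMap.toContinuousLinearMap g with hG
  have hGg : G.toLinearMap = g := by rw [hG]; rfl
  refine (Metric.isBounded_closedBall (x := (0 : ℂ)) (r := 1 + 8 * ‖G‖)).subset ?_
  intro y hy
  rw [mem_closedBall_zero_iff]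
  by_contra! h
  apply hy
  rw [← hGg]
  have := norm_nonneg G
  refine mem_inversionImage_of_large G ?_ ?_
  · rintro rfl; rw [norm_zero] at h; linarith
  · nlinarith

/-! ### The case `α ≠ β`: reduction to the inversion map. -/

/-- The real linear map sending `w` to the imaginary part of `(γ w, w)`. -/
def imLine (γ : ℂ) : ℂ →ₗ[ℝ] (Fin 2 → ℝ) where
  toFun w := ![(γ * w).im, w.im]
  map_add' a b := by ext i; fin_cases i <;> simp; ring
  map_smul' r a := by ext i; fin_cases i <;> simp; ring

lemma imLine_injective {γ : ℂ} (hγ : γ.im ≠ 0) : Function.Injective (imLine γ) := by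
  rw [injective_iff_map_eq_zero]
  intro w hw
  have h0 : (γ * w).im = 0 := congrFun hw 0
  have h1 : w.im = 0 := congrFun hw 1
  rw [Complex.mul_im, h1, mul_zero, zero_add] at h0
  exact Complex.ext ((mul_eq_zero.mp h0).resolve_left hγ) h1

/-- `imLine γ` as an isomorphism, for `γ` not real. -/
noncomputable def imLineEquiv {γ : ℂ} (hγ : γ.im ≠ 0) : ℂ ≃ₗ[ℝ] (Fin 2 → ℝ) :=
  LinearEquiv.ofInjectiveOfFinrankEq (imLine γ) (imLine_injective hγ)
    (by rw [Complex.finrank_real_complex]; simp)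

lemma imLineEquiv_apply {γ : ℂ} (hγ : γ.im ≠ 0) (w : ℂ) : imLineEquiv hγ w = imLine γ w := rfl

lemma mem_imagProjection_factoredConic {α β d e f : ℂ} {y : Fin 2 → ℝ} :
    y ∈ imagProjection (factoredConic α β d e f) ↔ ∃ z₁ z₂ : ℂ,
      (z₁ - α * z₂) * (z₁ - β * z₂) + d * z₁ + e * z₂ + f = 0 ∧ y = ![z₁.im, z₂.im] := by
  constructor
  · rintro ⟨z, hz, rfl⟩
    refine ⟨z 0, z 1, by simpa [factoredConic] using hz, ?_⟩
    ext i; fin_cases i <;> rfl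
  · rintro ⟨z₁, z₂, h, rfl⟩
    refine ⟨![z₁, z₂], by simpa [factoredConic] using h, ?_⟩
    ext i; fin_cases i <;> rfl

/-- Completing the product: a translation removes the linear part. -/
lemma exists_translation {α β : ℂ} (h : α ≠ β) (d e f : ℂ) : ∃ s₁ s₂ c : ℂ, ∀ z₁ z₂ : ℂ,
    ((z₁ + s₁) - α * (z₂ + s₂)) * ((z₁ + s₁) - β * (z₂ + s₂)) + d * (z₁ + s₁) + e * (z₂ + s₂) + f
      = (z₁ - α * z₂) * (z₁ - β * z₂) + c := by
  have h' : α - β ≠ 0 := sub_ne_zero.mpr h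
  obtain ⟨b, hb⟩ : ∃ b : ℂ, b * (α - β) = e + β * d := ⟨(e + β * d) / (α - β), by field_simp⟩
  obtain ⟨s₂, hs⟩ : ∃ s₂ : ℂ, s₂ * (α - β) = d + 2 * b := ⟨(d + 2 * b) / (α - β), by field_simp⟩
  refine ⟨b + β * s₂, s₂, ((b + β * s₂) - α * s₂) * ((b + β * s₂) - β * s₂) + d * (b + β * s₂)
    + e * s₂ + f, fun z₁ z₂ => ?_⟩
  linear_combination (-z₁ + β * z₂) * hs - z₂ * hb

lemma isPreconnected_isBounded_of_ne {α β : ℂ} (hα : α.im ≠ 0) (hβ : β.im ≠ 0) (h : α ≠ β)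
    (d e f : ℂ) : IsPreconnected (imagProjection (factoredConic α β d e f))ᶜ ∧
      Bornology.IsBounded (imagProjection (factoredConic α β d e f))ᶜ := by
  obtain ⟨s₁, s₂, c, hs⟩ := exists_translation h d e f
  have h' : β - α ≠ 0 := sub_ne_zero.mpr h.symm
  set E := imLineEquiv hβ with hE
  set t : Fin 2 → ℝ := ![s₁.im, s₂.im] with ht
  by_cases hc : c = 0
  · have : imagProjection (factoredConic α β d e f) = Set.univ := by
      rw [Set.eq_univ_iff_forall]
      intro y
      rw [mem_imagProjection_factoredConic]
      have hw : imLine β (E.symm (y - t)) = y - t := E.apply_symm_apply (y - t)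
      set w := E.symm (y - t)
      refine ⟨β * w + s₁, w + s₂, by rw [hs, hc]; ring, ?_⟩
      rw [sub_eq_iff_eq_add.mp hw.symm, ht]
      ext i; fin_cases i <;> simp [imLine]
    rw [this, Set.compl_univ]
    exact ⟨isPreconnected_empty, Bornology.isBounded_empty⟩
  set C : ℂ := c / (β - α) ^ 2 with hC
  have hCc : C * (β - α) ^ 2 = c := by rw [hC]; field_simp
  have hC0 : C ≠ 0 := div_ne_zero hc (pow_ne_zero 2 h')
  let g : ℂ →ₗ[ℝ] ℂ := E.symm.toLinearMap ∘ₗ imLine α ∘ₗ (LinearMap.mulLeft ℝ C) ∘ₗ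
    Complex.conjAe.toLinearMap
  have hg : Function.Injective g := by
    exact E.symm.injective.comp ((imLine_injective hα).comp
      ((mul_right_injective₀ hC0).comp Complex.conjAe.injective))
  have hEg (w : ℂ) : E ((Complex.normSq w)⁻¹ • g w) = imLine α (C / w) := by
    have e1 : E (g w) = imLine α (C * starRingEnd ℂ w) := E.apply_symm_apply _
    rw [map_smul, e1, ← map_smul]
    congr 1
    rw [Complex.real_smul, div_eq_mul_inv, Complex.inv_def]
    ring
  have hI : imagProjection (factoredConic α β d e f) = (fun x => E x + t) '' inversionImage g := by
    ext y
    rw [mem_imagProjection_factoredConic]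
    constructor
    · rintro ⟨z₁, z₂, hz, rfl⟩
      have hz' := hs (z₁ - s₁) (z₂ - s₂)
      rw [sub_add_cancel, sub_add_cancel, hz] at hz'
      obtain ⟨Z₁, hZ₁⟩ : ∃ Z₁, Z₁ = z₁ - s₁ := ⟨_, rfl⟩
      obtain ⟨Z₂, hZ₂⟩ : ∃ Z₂, Z₂ = z₂ - s₂ := ⟨_, rfl⟩
      rw [← hZ₁, ← hZ₂] at hz'
      obtain ⟨w, hw⟩ : ∃ w, w * (β - α) = Z₁ - α * Z₂ :=
        ⟨(Z₁ - α * Z₂) / (β - α), by field_simp⟩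
      have hw0 : w ≠ 0 := by
        rintro rfl
        rw [← hw] at hz'
        apply hc; linear_combination -hz'
      have hq : C / w = Z₂ - w := by
        rw [div_eq_iff hw0]
        apply mul_right_cancel₀ (pow_ne_zero 2 h')
        rw [hCc]
        linear_combination -hz' + (w * (β - α) + Z₁ - α * Z₂ - Z₂ * (β - α)) * hw
      refine ⟨w + (Complex.normSq w)⁻¹ • g w, ⟨w, hw0, rfl⟩, ?_⟩
      have hz₁ : z₁ = β * w + α * (C / w) + s₁ := by
        rw [hq]; linear_combination -hZ₁ - hw
      have hz₂ : z₂ = w + C / w + s₂ := by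
        rw [hq]; linear_combination -hZ₂
      dsimp only
      rw [map_add, hEg, hE, imLineEquiv_apply, ht, hz₁, hz₂]
      ext i; fin_cases i <;> simp [imLine]
    · rintro ⟨x, ⟨w, hw0, rfl⟩, rfl⟩
      refine ⟨β * w + α * (C / w) + s₁, w + C / w + s₂, ?_, ?_⟩
      · rw [hs, ← hCc]; field_simp; ring
      · dsimp only
        rw [map_add, hEg, hE, imLineEquiv_apply, ht]
        ext i; fin_cases i <;> simp [imLine]
  have hbij : Function.Bijective (fun x => E x + t) :=
    (Equiv.addRight t).bijective.comp E.bijective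
  have hcont : Continuous (E : ℂ → Fin 2 → ℝ) := E.toLinearMap.continuous_of_finiteDimensional
  rw [hI, ← Set.image_compl_eq hbij]
  constructor
  · refine IsPreconnected.image ?_ _ (by fun_prop)
    by_cases h0 : (0 : ℂ) ∈ inversionImage g
    · rw [Set.eq_univ_of_forall (mem_inversionImage_of_zero_mem hg h0), Set.compl_univ]
      exact isPreconnected_empty
    · exact ((starConvex_compl_inversionImage hg).isPathConnected h0).isConnected.isPreconnected
  · have hb := (LinearMap.toContinuousLinearMap E.toLinearMap).lipschitz.isBounded_image
      (isBounded_compl_inversionImage g)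
    have hb2 := (LipschitzWith.id.add (LipschitzWith.const t)).isBounded_image hb
    rw [Set.image_image] at hb2
    exact hb2

/-! ### The case `α = β`. -/

lemma exists_sq_eq_sub_mul_im (W n : ℂ) : ∃ U : ℂ, U ^ 2 = W - n * U.im := by
  suffices H : ∃ x s : ℝ, x ^ 2 - s ^ 2 = W.re - n.re * s ∧ 2 * x * s = W.im - n.im * s by
    obtain ⟨x, s, h1, h2⟩ := H
    refine ⟨⟨x, s⟩, Complex.ext ?_ ?_⟩
    · simp [pow_two]; linarith
    · simp [pow_two]; linarith
  by_cases hW : W.im = 0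
  · rcases le_or_gt 0 W.re with h | h
    · exact ⟨√W.re, 0, by rw [Real.sq_sqrt h]; ring, by rw [hW]; ring⟩
    · have hd : 0 ≤ n.re ^ 2 + n.im ^ 2 - 4 * W.re := by
        nlinarith [sq_nonneg n.re, sq_nonneg n.im]
      refine ⟨-n.im / 2, (n.re + √(n.re ^ 2 + n.im ^ 2 - 4 * W.re)) / 2, ?_, by rw [hW]; ring⟩
      linear_combination -(1 / 4) * Real.sq_sqrt hd
  -- Eliminating `x = (W.im - n.im * s) / (2 * s)` and clearing `s²` leaves the quartic `F`, with `F
  -- 0 > 0` and leading behaviour making `F N ≤ 0`.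
  let F : ℝ → ℝ := fun s => (W.im - n.im * s) ^ 2 / 4 - s ^ 4 + n.re * s ^ 3 - W.re * s ^ 2
  have hF0 : 0 < F 0 := by
    have : 0 < W.im ^ 2 := by positivity
    simp only [F]; nlinarith
  set N : ℝ := 2 * (1 + |W.im| + |n.im| + |n.re| + |W.re|) with hN
  have a1 := abs_nonneg W.im
  have a2 := abs_nonneg n.im
  have a3 := abs_nonneg n.re
  have a4 := abs_nonneg W.re
  have hN1 : 1 ≤ N := by linarith
  have hFN : F N ≤ 0 := by
    have b1 : |W.im - n.im * N| ≤ N ^ 2 / 2 := by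
      calc |W.im - n.im * N| ≤ |W.im| + |n.im * N| := abs_sub _ _
        _ = |W.im| + |n.im| * N := by rw [abs_mul, abs_of_nonneg (by linarith : 0 ≤ N)]
        _ ≤ (|W.im| + |n.im|) * N := by nlinarith
        _ ≤ N / 2 * N := by gcongr; linarith
        _ = _ := by ring
    have b2 : (W.im - n.im * N) ^ 2 ≤ (N ^ 2 / 2) ^ 2 := by
      rw [← sq_abs]; gcongr
    have b3 : n.re * N ^ 3 ≤ |n.re| * N ^ 3 := by gcongr; exact le_abs_self _
    have b4 : -W.re * N ^ 2 ≤ |W.re| * N ^ 3 := by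
      calc -W.re * N ^ 2 ≤ |W.re| * N ^ 2 := by gcongr; exact neg_le_abs _
        _ ≤ _ := by gcongr; norm_num
    have b5 : (|n.re| + |W.re|) * N ^ 3 ≤ N / 2 * N ^ 3 := by gcongr; linarith
    simp only [F]
    nlinarith [pow_nonneg (by linarith : 0 ≤ N) 4]
  have hcont : ContinuousOn F (Set.Icc 0 N) := by
    apply Continuous.continuousOn; simp only [F]; fun_prop
  obtain ⟨s, -, hs⟩ := intermediate_value_Icc' (by linarith) hcont ⟨hFN, hF0.le⟩
  have hs0 : s ≠ 0 := by rintro rfl; exact hF0.ne' hs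
  refine ⟨(W.im - n.im * s) / (2 * s), s, ?_, by field_simp⟩
  simp only [F] at hs
  field_simp
  linear_combination 4 * hs

lemma imagProjection_factoredConic_self {α : ℂ} (hα : α.im ≠ 0) (d e f : ℂ) :
    imagProjection (factoredConic α α d e f) = Set.univ := by
  rw [Set.eq_univ_iff_forall]
  intro y
  rw [mem_imagProjection_factoredConic]
  have hsurj (y : Fin 2 → ℝ) : ∃ w, imLine α w = y :=
    ⟨_, (imLineEquiv hα).apply_symm_apply y⟩
  by_cases hh : d * α + e = 0
  · obtain ⟨r, hr⟩ := IsAlgClosed.exists_pow_nat_eq (d ^ 2 - 4 * f) (n := 2) (by norm_num)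
    obtain ⟨w, hw⟩ := hsurj (y - ![((r - d) / 2).im, 0])
    refine ⟨(r - d) / 2 + α * w, w, by linear_combination (1 / 4) * hr + w * hh, ?_⟩
    rw [sub_eq_iff_eq_add.mp hw.symm]
    ext i; fin_cases i <;> simp [imLine, add_comm]
  · set k := -(d * α + e)⁻¹ with hk
    have hk0 : k ≠ 0 := neg_ne_zero.mpr (inv_ne_zero hh)
    have hkh : k * (d * α + e) = -1 := by rw [hk]; field_simp
    set s := k * (f - d ^ 2 / 4) with hs
    obtain ⟨w, hw⟩ := hsurj (y - ![(-d / 2 + α * s).im, s.im])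
    -- With `U = z₁ - α z₂ + d/2` the curve is `z₂ = k U² + s`. The extra vector `(Im U, 0)` is
    -- `imLine α` of the real number `Im U / Im α`, so the condition becomes `k U² = w - Im U / Im
    -- α`.
    obtain ⟨U, hU⟩ := exists_sq_eq_sub_mul_im (k⁻¹ * w) (k⁻¹ * ((α.im)⁻¹ : ℝ))
    have hkU : k * U ^ 2 = w - ((α.im)⁻¹ * U.im : ℝ) := by
      rw [hU]; push_cast; field_simp
    refine ⟨U - d / 2 + α * (k * U ^ 2 + s), k * U ^ 2 + s, ?_, ?_⟩
    · rw [hs]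
      linear_combination (U ^ 2 + f - d ^ 2 / 4) * hkh
    · rw [sub_eq_iff_eq_add.mp hw.symm, hkU]
      ext i
      fin_cases i
      · simp [imLine, -Complex.ofReal_mul]
        field_simp
        ring
      · simp [imLine, -Complex.ofReal_mul]

theorem lemma6p1 (α β d e f : ℂ) (hα : α.im ≠ 0) (hβ : β.im ≠ 0) :
    {K | K ∈ components (imagProjection (factoredConic α β d e f))ᶜ ∧
      Bornology.IsBounded K}.Subsingleton ∧
    ¬ ∃ K ∈ components (imagProjection (factoredConic α β d e f))ᶜ,
      ¬ Bornology.IsBounded K := by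
  obtain ⟨hc, hb⟩ : IsPreconnected (imagProjection (factoredConic α β d e f))ᶜ ∧
      Bornology.IsBounded (imagProjection (factoredConic α β d e f))ᶜ := by
    by_cases h : α = β
    · subst h
      rw [imagProjection_factoredConic_self hα, Set.compl_univ]
      exact ⟨isPreconnected_empty, Bornology.isBounded_empty⟩
    · exact isPreconnected_isBounded_of_ne hα hβ h d e f
  constructor
  · rintro _ ⟨⟨y, hy, rfl⟩, -⟩ _ ⟨⟨y', hy', rfl⟩, -⟩
    rw [hc.connectedComponentIn hy, hc.connectedComponentIn hy']
  · rintro ⟨_, ⟨y, -, rfl⟩, hK⟩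
    exact hK (hb.subset (connectedComponentIn_subset _ _))
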